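/- Let $s,Q\ge 1$ be integers, $N=sQ$, $P_x>0$, $\sigma_w>0$, and fix a delay $t_d\in\{0,\dots,Q-1\}$. Signal. Let $\mathbf x=(x_1,\dots,x_N)\sim\mathcal{CN}(0,K_{\mathbf x})$ be a complex proper zero-mean Gaussian vector that is low-pass circularly wide-sense stationary: $K_{\mathbf x}=\mathbb E[\mathbf x\mathbf x^\dagger]$ is circulant with $\operatorname{tr}K_{\mathbf x}=P_x$, and the $k$-th column ($k=0,\dots,N-1$) of the DFT matrix with entries $\frac1{\sqrt N}e^{-2\pi j tk/N}$, $0\le t,k\le N-1$, is an eigenvector of $K_{\mathbf x}$ with eigenvalue $P_x/s$ if $k\le s-1$ and with eigenvalue $0$ otherwise. Energy. Let $E_1,\dots,E_N$ be i.i.d. random variables with $0\le E_t\le E_{\max}$ almost surely, mean $\mu_E>0$ and variance $\varrho_E$, and write $E_{\max}=r_E\,\mu_E$. Let $\bar E_k=\sum_{t=1}^{Q}E_{(k-1)Q+t}$, $k=1,\dots,s$, be the energy collected in slot $k$. Transmission. At the end of slot $k$ one sample is sent, $y_k=\sqrt{p_k}\,x_{Q(k-1)+t_d+1}+w_k$,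 $k=1,\dots,s$, where $\mathbf w=(w_1,\dots,w_s)\sim\mathcal{CN}(0,\sigma_w^2I_s)$ is complex proper zero-mean Gaussian and independent of $\mathbf x$, and where $p_k\ge0$ uses all the stored energy: $\mathbb E_S\big[|\sqrt{p_k}\,x_{Q(k-1)+t_d+1}|^2\big]=\bar E_k$. Here $\mathbb E_S$ is the expectation over $(\mathbf x,\mathbf w)$ for a fixed realization of the energy arrivals. Let $$\varepsilon=\mathbb E_S\big[\|\mathbf x-\mathbb E_S[\mathbf x\mid\mathbf y]\|^2\big]$$ be the minimum mean-square error, which is a function of the energy arrivals. Bounds. With $h(a)=(1+a)\log(1+a)-a$ put $$f_{bt}(\mu,\varrho,r)=2s\exp\Big(-\frac{\varrho}{\mu^2}\,h\Big(\frac{\mu r}{\varrho}\Big)\Big),\qquad f_{bn}(\mu,\varrho,r)=2s\exp\Big(-\frac{r^2/2}{\mu r/3+\varrho}\Big),$$ where $f_{bt}(\mu,0,r)=0$, the limit as $\varrho\downarrow0$. Then for every $r\in(0,1)$, with probability taken over the energy arrivals, $$\mathbb P\Big(\varepsilon<\frac{P_x}{1+\frac1{\sigma_w^2}\,\mu_E\,\frac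 Ns\,(1-r)}\Big)\ \ge\ 1-f_{bt}(\mu_I^u,\varrho_I^u,r)\ \ge\ 1-f_{bn}(\mu_I^u,\varrho_I^u,r),$$ where $\mu_I^u=\max\{r_E-1,1\}$ and $\varrho_I^u=\dfrac{\varrho_E}{\mu_E^2}\,\dfrac sN$. -/

import Mathlib

open MeasureTheory ProbabilityTheory

noncomputable section

/-- `X ∼ CN(0, K)`: complex proper (circularly symmetric) zero-mean Gaussian random vector with
covariance matrix `E[X X†] = K`; properness is the vanishing of the pseudo-covariance `E[X Xᵀ]`.
The law may be degenerate. -/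
structure IsProperGaussian {Ω ι : Type*} [MeasurableSpace Ω] [Fintype ι]
    (X : Ω → EuclideanSpace ℂ ι) (K : Matrix ι ι ℂ) (P : Measure Ω) : Prop where
  measurable : Measurable X
  gaussian : HasGaussianLaw X P
  mean_zero : ∀ i, ∫ ω, X ω i ∂P = 0
  covariance : ∀ i j, ∫ ω, X ω i * star (X ω j) ∂P = K i j
  proper : ∀ i j, ∫ ω, X ω i * X ω j ∂P = 0

/-- The unitary discrete Fourier transform matrix of size `N`, with indices starting at `0`. -/
def dftMatrix (N : ℕ) : Matrix (Fin N) (Fin N) ℂ :=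
  Matrix.of fun t k =>
    (1 / (Real.sqrt N : ℂ)) *
      Complex.exp (-Complex.I * (2 * Real.pi / N) * ((t : ℕ) : ℂ) * ((k : ℕ) : ℂ))

/-- A covariance matrix is that of a circularly wide-sense stationary signal if it is circulant:
the entry in row `t` and column `k` depends only on `k - t` modulo `N`. -/
def IsCWSS {N : ℕ} (K : Matrix (Fin N) (Fin N) ℂ) : Prop :=
  ∃ K₁ : Fin N → ℂ, ∀ t k, K t k = K₁ (k - t)

/-- Low-pass c.w.s.s. covariance matrix with `s` degrees of freedom and total power `Px`: it is
circulant with trace `Px`, the low frequencies `0, …, s - 1` (columns of the DFT matrix) are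
eigenvectors for the eigenvalue `Px / s`, and all the other frequencies for the eigenvalue `0`. -/
structure IsLowPassCWSS {N : ℕ} (s : ℕ) (Px : ℝ) (K : Matrix (Fin N) (Fin N) ℂ) : Prop where
  cwss : IsCWSS K
  trace_eq : K.trace = (Px : ℂ)
  low_pass : ∀ k : Fin N, K.mulVec (fun t => dftMatrix N t k) =
    (if (k : ℕ) < s then ((Px / s : ℝ) : ℂ) else 0) • (fun t => dftMatrix N t k)

/-- Position (starting at `0`) of the `t`-th epoch of the `k`-th slot when `N = s * Q` epochs are
divided into `s` consecutive slots of length `Q`; its value is `Q * k + t`. -/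
def epoch {N s Q : ℕ} (hN : N = s * Q) (k : Fin s) (t : Fin Q) : Fin N :=
  Fin.cast hN.symm (finProdFinEquiv (k, t))

/-- Total energy that arrives during slot `k`. -/
def slotEnergy {N s Q : ℕ} (hN : N = s * Q) (e : Fin N → ℝ) (k : Fin s) : ℝ :=
  ∑ t : Fin Q, e (epoch hN k t)

/-- Average energy (over the signal) used in slot `k` for sending the sample with offset `td` with
amplification `√p`. -/
def usedEnergy {Ω : Type*} [MeasurableSpace Ω] (P : Measure Ω) {N s Q : ℕ} (hN : N = s * Q)
    (td : Fin Q) (x : Ω → EuclideanSpace ℂ (Fin N)) (k : Fin s) (p : ℝ) : ℝ :=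
  ∫ ω, ‖(Real.sqrt p : ℂ) * x ω (epoch hN k td)‖ ^ 2 ∂P

/-- Received signal of the equidistant single-sample scheme: in slot `k` it is
`√(p k) * x_{Q k + td} + w_k`. -/
def received {Ω : Type*} {N s Q : ℕ} (hN : N = s * Q) (td : Fin Q)
    (x : Ω → EuclideanSpace ℂ (Fin N)) (w : Ω → EuclideanSpace ℂ (Fin s)) (p : Fin s → ℝ) :
    Ω → EuclideanSpace ℂ (Fin s) :=
  fun ω => WithLp.toLp 2 fun k => (Real.sqrt (p k) : ℂ) * x ω (epoch hN k td) + w ω k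

/-- Minimum mean-square error `E ‖x - E[x | y]‖²` of estimating `x` from `y`. -/
def mmse {Ω : Type*} [MeasurableSpace Ω] (P : Measure Ω) {N m : ℕ}
    (x : Ω → EuclideanSpace ℂ (Fin N)) (y : Ω → EuclideanSpace ℂ (Fin m)) : ℝ :=
  ∫ ω, ‖x ω - (P[x | MeasurableSpace.comap y inferInstance]) ω‖ ^ 2 ∂P

/-- `h(a) = (1 + a) log (1 + a) - a`. -/
def bennettH (a : ℝ) : ℝ := (1 + a) * Real.log (1 + a) - a

/-- The Bennett-type tail `2 s exp(-(ϱ / μ²) h(μ r / ϱ))`. The formula divides by `ϱ`; at `ϱ = 0` the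
value is its limit `0` as `ϱ ↓ 0` (for `μ, r > 0`). -/
def fbt (s : ℕ) (μ ϱ r : ℝ) : ℝ :=
  if ϱ = 0 then 0 else 2 * s * Real.exp (-(ϱ / μ ^ 2) * bennettH (μ * r / ϱ))

/-- The Bernstein-type tail `2 s exp(-(r² / 2) / (μ r / 3 + ϱ))`. -/
def fbn (s : ℕ) (μ ϱ r : ℝ) : ℝ :=
  2 * s * Real.exp (-((r ^ 2 / 2) / (μ * r / 3 + ϱ)))

end

/-! Two independent halves meet in a union bound. Signal: the covariance is `K = U D U†` with `U`
the DFT and `D` equal to `Px / s` on `s` frequencies and `0` elsewhere, so `K` is `Px / s` times an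
orthogonal projection and `K * K = (Px / s) • K`. Samples taken `Q` epochs apart see these
frequencies as a complete `s`-point DFT, hence are uncorrelated with variance `Px / N`, and so are
the received values `y_k`. The best linear estimator then splits over the slots, and `K * K = (Px /
s) • K` evaluates its error as `∑ k, (Px / s) / (1 + e_k / σw ^ 2)`, where `e_k = p_k * Px / N` is
the energy of slot `k`. The conditional expectation does no worse (`mmse_received_le`). Since only
an upper bound is needed, second moments suffice here. Energy: if every `e_k` exceeds `μE * Q * (1 -
r)`, each summand is strictly below the corresponding constant and the claimed bound follows. A slot
fails with probability controlled by Bennett's inequality for the normalized deficits `(μE - E_t) /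
(μE * Q)`, whose variances add up to `ϱE / μE ^ 2 * (s / N)` (`measure_slotEnergy_le_le`). Summing
over `s` slots gives `fbt`; Bernstein's form follows from an elementary lower bound on `bennettH`.
-/

/-! ### Bennett's inequality -/

/-- Taylor's formula with integral remainder for the exponential function. -/
theorem exp_sub_one_sub_eq_integral (u : ℝ) :
    Real.exp u - 1 - u = u ^ 2 * ∫ t in (0 : ℝ)..1, (1 - t) * Real.exp (t * u) := by
  have hd : ∀ t ∈ Set.uIcc (0 : ℝ) 1,
      HasDerivAt (fun t => (1 - t) * u * Real.exp (t * u) + Real.exp (t * u))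
        (u ^ 2 * ((1 - t) * Real.exp (t * u))) t := by
    intro t _
    have h1 : HasDerivAt (fun t : ℝ => Real.exp (t * u)) (Real.exp (t * u) * (1 * u)) t :=
      ((hasDerivAt_id t).mul_const u).exp
    have h2 : HasDerivAt (fun t : ℝ => (1 - t) * u) (-1 * u) t :=
      ((hasDerivAt_id t).const_sub 1).mul_const u
    refine ((h2.mul h1).add h1).congr_deriv ?_
    ring
  have h := intervalIntegral.integral_eq_sub_of_hasDerivAt hd
    (Continuous.intervalIntegrable (by fun_prop) _ _)
  rw [intervalIntegral.integral_const_mul] at h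
  rw [h]
  simp
  ring

/-- The function `(exp u - 1 - u) / u ^ 2` is increasing, because its integral representation has an
integrand increasing in `u`. Only `c` is divided by, so `u = 0` and negative `u` need no separate
case. -/
theorem exp_sub_one_sub_le {u c : ℝ} (huc : u ≤ c) (hc : 0 < c) :
    Real.exp u - 1 - u ≤ u ^ 2 / c ^ 2 * (Real.exp c - 1 - c) := by
  rw [exp_sub_one_sub_eq_integral u, exp_sub_one_sub_eq_integral c, div_mul_eq_mul_div,
    mul_div_assoc, mul_div_cancel_left₀ _ (by positivity)]
  refine mul_le_mul_of_nonneg_left ?_ (sq_nonneg u)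
  refine intervalIntegral.integral_mono_on zero_le_one
    (Continuous.intervalIntegrable (by fun_prop) _ _)
    (Continuous.intervalIntegrable (by fun_prop) _ _) fun t ht => ?_
  have h0 := ht.1
  have h1 : 0 ≤ 1 - t := by linarith [ht.2]
  gcongr

theorem integrable_exp_mul_of_ae_le {Ω : Type*} [MeasurableSpace Ω] {P : Measure Ω}
    [IsFiniteMeasure P] {X : Ω → ℝ} {b l : ℝ} (hX : AEMeasurable X P)
    (hb : ∀ᵐ ω ∂P, X ω ≤ b) (hl : 0 ≤ l) : Integrable (fun ω => Real.exp (l * X ω)) P := by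
  refine Integrable.of_bound (C := Real.exp (l * b))
    (by fun_prop : AEMeasurable _ P).aestronglyMeasurable ?_
  filter_upwards [hb] with ω hω
  rw [Real.norm_eq_abs, Real.abs_exp]
  gcongr

/-- Bennett's bound on the moment generating function of a centered random variable that is
bounded above. -/
theorem mgf_le_exp_of_ae_le {Ω : Type*} [MeasurableSpace Ω] {P : Measure Ω}
    [IsProbabilityMeasure P] {X : Ω → ℝ} {b l : ℝ} (hX : MemLp X 2 P)
    (hb : ∀ᵐ ω ∂P, X ω ≤ b) (hb0 : 0 < b) (hmean : ∫ ω, X ω ∂P = 0) (hl : 0 < l) :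
    mgf X P l ≤ Real.exp (variance X P / b ^ 2 * (Real.exp (l * b) - 1 - l * b)) := by
  set C := (Real.exp (l * b) - 1 - l * b) / b ^ 2 with hC
  have hint1 : Integrable X P := hX.integrable one_le_two
  have hint2 : Integrable (fun ω => X ω ^ 2) P := hX.integrable_sq
  have hint3 : Integrable (fun ω => 1 + l * X ω) P :=
    (integrable_const 1).add (hint1.const_mul l)
  have hvar : variance X P = ∫ ω, X ω ^ 2 ∂P :=
    variance_of_integral_eq_zero hX.aemeasurable hmean
  calc mgf X P l ≤ ∫ ω, (1 + l * X ω + C * X ω ^ 2) ∂P := by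
        refine integral_mono_ae (integrable_exp_mul_of_ae_le hX.aemeasurable hb hl.le)
          (hint3.add (hint2.const_mul C)) ?_
        filter_upwards [hb] with ω hω
        have h := exp_sub_one_sub_le (mul_le_mul_of_nonneg_left hω hl.le) (mul_pos hl hb0)
        have h' : (l * X ω) ^ 2 / (l * b) ^ 2 * (Real.exp (l * b) - 1 - l * b)
            = C * X ω ^ 2 := by
          rw [hC]; field_simp
        linarith
    _ = variance X P * C + 1 := by
        rw [integral_add hint3 (hint2.const_mul C),
          integral_add (integrable_const 1) (hint1.const_mul l), integral_const_mul,
          integral_const_mul, hmean, hvar]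
        simp
        ring
    _ ≤ Real.exp (variance X P * C) := Real.add_one_le_exp _
    _ = _ := by rw [hC]; congr 1; ring

/-- **Bennett's inequality** for a sum of independent centered random variables that are bounded
above by `b`. -/
theorem bennett_inequality {Ω ι : Type*} [MeasurableSpace Ω] {P : Measure Ω}
    [IsProbabilityMeasure P] [Fintype ι] {X : ι → Ω → ℝ} {b V r : ℝ} (hind : iIndepFun X P)
    (hX : ∀ i, MemLp (X i) 2 P) (hb : ∀ i, ∀ᵐ ω ∂P, X i ω ≤ b) (hb0 : 0 < b)
    (hmean : ∀ i, ∫ ω, X i ω ∂P = 0) (hV : ∑ i, variance (X i) P = V) (hV0 : 0 < V)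
    (hr : 0 < r) :
    P.real {ω | r ≤ ∑ i, X i ω} ≤ Real.exp (-(V / b ^ 2) * bennettH (b * r / V)) := by
  have ha : 0 < b * r / V := by positivity
  set a := b * r / V with hadef
  -- The minimizer of the Chernoff exponent `-l * r + V / b ^ 2 * (exp (l * b) - 1 - l * b)`:
  -- stationarity reads `exp (l * b) = 1 + b * r / V`.
  set l := Real.log (1 + a) / b with hldef
  have hl : 0 < l := div_pos (Real.log_pos (by linarith)) hb0
  have hlb : l * b = Real.log (1 + a) := by rw [hldef]; field_simp
  have hbd : ∀ᵐ ω ∂P, (∑ i, X i) ω ≤ ∑ _i : ι, b := by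
    filter_upwards [ae_all_iff.2 hb] with ω hω
    rw [Finset.sum_apply]
    exact Finset.sum_le_sum fun i _ => hω i
  have hsum : AEMeasurable (∑ i, X i) P :=
    Finset.aemeasurable_sum _ fun i _ => (hX i).aemeasurable
  have h1 := measure_ge_le_exp_mul_mgf (X := ∑ i, X i) r hl.le
    (integrable_exp_mul_of_ae_le hsum hbd hl.le)
  simp only [Finset.sum_apply] at h1
  refine h1.trans ?_
  rw [hind.mgf_sum₀ (fun i => (hX i).aemeasurable)]
  calc Real.exp (-l * r) * ∏ i, mgf (X i) P l
      ≤ Real.exp (-l * r) * ∏ i, Real.exp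
          (variance (X i) P / b ^ 2 * (Real.exp (l * b) - 1 - l * b)) := by
        refine mul_le_mul_of_nonneg_left ?_ (Real.exp_pos _).le
        exact Finset.prod_le_prod (fun i _ => mgf_nonneg)
          fun i _ => mgf_le_exp_of_ae_le (hX i) (hb i) hb0 (hmean i) hl
    _ = _ := by
        rw [← Real.exp_sum, ← Finset.sum_mul, ← Finset.sum_div, hV, ← Real.exp_add, hlb,
          Real.exp_log (by linarith), bennettH, hldef]
        congr 1
        have hr' : r = a * V / b := by rw [hadef]; field_simp
        rw [hr']
        field_simp
        ring

/-! ### Bennett's bound implies Bernstein's bound -/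

/-- Both sides vanish at `0`, and the derivatives compare because `(1 + t / 3) ^ 3 ≥ 1 + t`. The
left side is the derivative of `a ^ 2 / 2 / (1 + a / 3)`, and the right side that of `bennettH`, so
integrating once more gives `le_bennettH`. -/
theorem le_log_one_add {a : ℝ} (ha : 0 ≤ a) :
    (a + a ^ 2 / 6) / (1 + a / 3) ^ 2 ≤ Real.log (1 + a) := by
  have hd : ∀ t : ℝ, 0 ≤ t →
      HasDerivAt (fun t => Real.log (1 + t) - (t + t ^ 2 / 6) / (1 + t / 3) ^ 2)
        (1 / (1 + t) - 1 / (1 + t / 3) ^ 3) t := by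
    intro t ht
    have h1 : HasDerivAt (fun t : ℝ => Real.log (1 + t)) (1 / (1 + t)) t :=
      ((hasDerivAt_id t).const_add 1).log (by simp; positivity)
    have h2 : HasDerivAt (fun t : ℝ => t + t ^ 2 / 6) (1 + (2 * t) / 6) t := by
      refine ((hasDerivAt_id t).add ((hasDerivAt_pow 2 t).div_const 6)).congr_deriv ?_
      simp
    have h3 : HasDerivAt (fun t : ℝ => (1 + t / 3) ^ 2) (2 * (1 + t / 3) * (1 / 3)) t := by
      refine ((((hasDerivAt_id t).div_const 3).const_add 1).pow 2).congr_deriv ?_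
      simp
    refine (h1.sub (h2.div h3 (by positivity))).congr_deriv ?_
    congr 1
    field_simp
    ring
  have hmono : MonotoneOn (fun t => Real.log (1 + t) - (t + t ^ 2 / 6) / (1 + t / 3) ^ 2)
      (Set.Ici 0) := by
    refine monotoneOn_of_deriv_nonneg (convex_Ici 0)
      (fun t ht => (hd t ht).continuousAt.continuousWithinAt)
      (fun t ht => (hd t (interior_subset ht)).differentiableAt.differentiableWithinAt)
      fun t ht => ?_
    have ht0 : 0 ≤ t := interior_subset ht
    rw [(hd t ht0).deriv, sub_nonneg]
    refine one_div_le_one_div_of_le (by positivity) ?_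
    have : (1 + t / 3) ^ 3 = 1 + t + (t ^ 2 / 3 + t ^ 3 / 27) := by ring
    rw [this]
    have : 0 ≤ t ^ 2 / 3 + t ^ 3 / 27 := by positivity
    linarith
  have h := hmono (Set.self_mem_Ici) ha ha
  simp only [add_zero, Real.log_one] at h
  norm_num at h
  linarith

theorem le_bennettH {a : ℝ} (ha : 0 ≤ a) : a ^ 2 / 2 / (1 + a / 3) ≤ bennettH a := by
  have hd : ∀ t : ℝ, 0 ≤ t →
      HasDerivAt (fun t => bennettH t - t ^ 2 / 2 / (1 + t / 3))
        (Real.log (1 + t) - (t + t ^ 2 / 6) / (1 + t / 3) ^ 2) t := by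
    intro t ht
    have h0 : HasDerivAt (fun t : ℝ => 1 + t) 1 t := (hasDerivAt_id t).const_add 1
    have h1 : HasDerivAt (fun t : ℝ => Real.log (1 + t)) (1 / (1 + t)) t :=
      h0.log (by positivity)
    have h2 : HasDerivAt (fun t : ℝ => t ^ 2 / 2) t t := by
      refine ((hasDerivAt_pow 2 t).div_const 2).congr_deriv ?_
      simp
    have h3 : HasDerivAt (fun t : ℝ => 1 + t / 3) (1 / 3) t :=
      ((hasDerivAt_id t).div_const 3).const_add 1
    refine (((h0.mul h1).sub (hasDerivAt_id t)).sub (h2.div h3 (by positivity))).congr_deriv ?_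
    field_simp
    ring
  have hmono : MonotoneOn (fun t => bennettH t - t ^ 2 / 2 / (1 + t / 3)) (Set.Ici 0) := by
    refine monotoneOn_of_deriv_nonneg (convex_Ici 0)
      (fun t ht => (hd t ht).continuousAt.continuousWithinAt)
      (fun t ht => (hd t (interior_subset ht)).differentiableAt.differentiableWithinAt)
      fun t ht => ?_
    have ht0 : 0 ≤ t := interior_subset ht
    rw [(hd t ht0).deriv, sub_nonneg]
    exact le_log_one_add ht0
  have h := hmono (Set.self_mem_Ici) ha ha
  simp [bennettH] at h
  simpa [bennettH] using h

theorem fbt_le_fbn (s : ℕ) {μ ϱ r : ℝ} (hμ : 0 < μ) (hϱ : 0 ≤ ϱ) (hr : 0 < r) :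
    fbt s μ ϱ r ≤ fbn s μ ϱ r := by
  unfold fbt fbn
  split_ifs with h
  · positivity
  have hϱ0 : 0 < ϱ := lt_of_le_of_ne hϱ (Ne.symm h)
  gcongr
  rw [neg_mul, neg_le_neg_iff]
  have hb := le_bennettH (a := μ * r / ϱ) (by positivity)
  calc r ^ 2 / 2 / (μ * r / 3 + ϱ)
      = ϱ / μ ^ 2 * ((μ * r / ϱ) ^ 2 / 2 / (1 + μ * r / ϱ / 3)) := by field_simp; ring
    _ ≤ _ := by gcongr

/-! ### Low-pass covariance matrices -/

theorem exp_neg_mul_star_exp_neg {n : ℕ} (a b f : ℕ) :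
    Complex.exp (-Complex.I * (2 * Real.pi / n) * a * f) *
      star (Complex.exp (-Complex.I * (2 * Real.pi / n) * b * f)) =
    (Complex.exp (2 * Real.pi * Complex.I / n) ^ b /
      Complex.exp (2 * Real.pi * Complex.I / n) ^ a) ^ f := by
  rw [Complex.star_def, ← Complex.exp_conj, ← Complex.exp_add, ← Complex.exp_nat_mul,
    ← Complex.exp_nat_mul, ← Complex.exp_sub, ← Complex.exp_nat_mul]
  congr 1
  simp only [map_mul, map_neg, map_div₀, Complex.conj_I, Complex.conj_ofReal, map_natCast,
    map_ofNat]
  ring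

/-- Orthogonality of the rows of the discrete Fourier transform. -/
theorem sum_exp_mul_star_exp {n a b : ℕ} (ha : a < n) (hb : b < n) :
    ∑ f ∈ Finset.range n, Complex.exp (-Complex.I * (2 * Real.pi / n) * a * f) *
      star (Complex.exp (-Complex.I * (2 * Real.pi / n) * b * f)) =
    if a = b then (n : ℂ) else 0 := by
  have hζ := Complex.isPrimitiveRoot_exp n (by omega)
  simp only [exp_neg_mul_star_exp_neg]
  set ζ := Complex.exp (2 * Real.pi * Complex.I / n)
  have hζ0 : ζ ≠ 0 := Complex.exp_ne_zero _
  split_ifs with h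
  · subst h
    simp [div_self (pow_ne_zero a hζ0)]
  · have hq : ζ ^ b / ζ ^ a ≠ 1 := by
      intro hq
      rw [div_eq_one_iff_eq (pow_ne_zero a hζ0)] at hq
      exact h (hζ.pow_inj hb ha hq).symm
    rw [geom_sum_eq hq, div_pow, ← pow_mul, ← pow_mul, mul_comm b, mul_comm a, pow_mul, pow_mul,
      hζ.pow_eq_one]
    simp

theorem dftMatrix_mul_star {N : ℕ} (t k f : Fin N) :
    dftMatrix N t f * star (dftMatrix N k f) = (1 / (N : ℂ)) *
      (Complex.exp (-Complex.I * (2 * Real.pi / N) * (t : ℕ) * (f : ℕ)) *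
        star (Complex.exp (-Complex.I * (2 * Real.pi / N) * (k : ℕ) * (f : ℕ)))) := by
  have h : (1 / (Real.sqrt N : ℂ)) * (1 / (Real.sqrt N : ℂ)) = 1 / (N : ℂ) := by
    rw [div_mul_div_comm, one_mul, ← Complex.ofReal_mul, Real.mul_self_sqrt (Nat.cast_nonneg N)]
    simp
  simp only [dftMatrix, Matrix.of_apply, star_mul', star_div₀, star_one, Complex.star_def,
    Complex.conj_ofReal, ← h]
  ring

theorem dftMatrix_mul_conjTranspose (N : ℕ) :
    dftMatrix N * (dftMatrix N).conjTranspose = 1 := by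
  ext t k
  have hN : (N : ℂ) ≠ 0 := Nat.cast_ne_zero.2 (by have := t.2; omega)
  simp only [Matrix.mul_apply, Matrix.conjTranspose_apply, dftMatrix_mul_star, ← Finset.mul_sum]
  rw [Finset.sum_range (fun f : ℕ => Complex.exp (-Complex.I * (2 * Real.pi / N) * (t : ℕ) * f) *
    star (Complex.exp (-Complex.I * (2 * Real.pi / N) * (k : ℕ) * f))) |>.symm,
    sum_exp_mul_star_exp t.2 k.2, Matrix.one_apply]
  by_cases h : t = k
  · simp [h, hN]
  · simp [h, Fin.val_ne_of_ne h]

section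

variable {N s Q : ℕ} {Px : ℝ} {K : Matrix (Fin N) (Fin N) ℂ}

/-- The spectral decomposition of a low-pass covariance matrix. -/
theorem IsLowPassCWSS.eq_mul_diagonal_mul (hK : IsLowPassCWSS s Px K) :
    K = dftMatrix N * Matrix.diagonal
      (fun k : Fin N => if (k : ℕ) < s then ((Px / s : ℝ) : ℂ) else 0) *
        (dftMatrix N).conjTranspose := by
  have h : K * dftMatrix N = dftMatrix N * Matrix.diagonal
      (fun k : Fin N => if (k : ℕ) < s then ((Px / s : ℝ) : ℂ) else 0) := by
    ext t k
    have := congrFun (hK.low_pass k) t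
    rw [Matrix.mul_diagonal, mul_comm (dftMatrix N t k)]
    exact this
  rw [← h, Matrix.mul_assoc, dftMatrix_mul_conjTranspose, Matrix.mul_one]

/-- All nonzero eigenvalues coincide. This later gives the squared norm of a column of `K` from a
diagonal entry. -/
theorem IsLowPassCWSS.mul_self (hK : IsLowPassCWSS s Px K) :
    K * K = ((Px / s : ℝ) : ℂ) • K := by
  have hU : (dftMatrix N).conjTranspose * dftMatrix N = 1 :=
    mul_eq_one_comm.1 (dftMatrix_mul_conjTranspose N)
  have hD := hK.eq_mul_diagonal_mul
  set U := dftMatrix N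
  set D := Matrix.diagonal (fun k : Fin N => if (k : ℕ) < s then ((Px / s : ℝ) : ℂ) else 0)
    with hDdef
  have hDD : D * D = ((Px / s : ℝ) : ℂ) • D := by
    rw [hDdef, Matrix.diagonal_mul_diagonal, ← Matrix.diagonal_smul]
    congr 1
    ext k
    simp only [Pi.smul_apply, smul_eq_mul]
    split_ifs <;> simp
  calc K * K = U * D * (U.conjTranspose * U) * (D * U.conjTranspose) := by
        rw [hD]; simp only [Matrix.mul_assoc]
    _ = U * (D * D) * U.conjTranspose := by rw [hU]; simp only [Matrix.mul_assoc, Matrix.one_mul]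
    _ = _ := by rw [hDD, hD, Matrix.mul_smul, Matrix.smul_mul]

theorem IsLowPassCWSS.isHermitian (hK : IsLowPassCWSS s Px K) : K.IsHermitian := by
  rw [hK.eq_mul_diagonal_mul, Matrix.IsHermitian]
  rw [Matrix.conjTranspose_mul, Matrix.conjTranspose_mul, Matrix.conjTranspose_conjTranspose,
    Matrix.diagonal_conjTranspose, Matrix.mul_assoc]
  congr 3
  ext k
  simp only [Pi.star_apply]
  split_ifs <;> simp

/-- With `s = 0` the matrix is empty, and its trace could not be the positive number `Px`. -/
theorem IsLowPassCWSS.pos (hK : IsLowPassCWSS s Px K) (hN : N = s * Q) (hPx : 0 < Px) :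
    0 < s := by
  rcases Nat.eq_zero_or_pos s with h | h
  · subst h
    obtain rfl : N = 0 := by simpa using hN
    have := hK.trace_eq
    simp only [Matrix.trace, Finset.univ_eq_empty, Finset.sum_empty] at this
    exact absurd (by exact_mod_cast this : (0 : ℝ) = Px) hPx.ne
  · exact h

theorem epoch_val (hN : N = s * Q) (k : Fin s) (t : Fin Q) :
    (epoch hN k t : ℕ) = t + Q * k := by
  simp [epoch]

/-- Equidistant samples of a low-pass signal at its Nyquist rate are uncorrelated. -/
theorem IsLowPassCWSS.apply_epoch (hK : IsLowPassCWSS s Px K) (hN : N = s * Q) (td : Fin Q)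
    (k l : Fin s) :
    K (epoch hN k td) (epoch hN l td) = if k = l then ((Px / N : ℝ) : ℂ) else 0 := by
  have hs : 0 < s := by have := k.2; omega
  have hQ : 0 < Q := by have := td.2; omega
  have hs' : (s : ℂ) ≠ 0 := Nat.cast_ne_zero.2 hs.ne'
  have hQ' : (Q : ℂ) ≠ 0 := Nat.cast_ne_zero.2 hQ.ne'
  have hsN : s ≤ N := by rw [hN]; exact Nat.le_mul_of_pos_right s hQ
  -- The common offset `td` cancels in the phase difference, and `Q / N = 1 / s` turns the `N`-point
  -- characters into `s`-point ones.
  have hphase : ∀ f : ℕ,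
      Complex.exp (-Complex.I * (2 * Real.pi / N) * ((epoch hN k td : ℕ) : ℂ) * f) *
        star (Complex.exp (-Complex.I * (2 * Real.pi / N) * ((epoch hN l td : ℕ) : ℂ) * f)) =
      Complex.exp (-Complex.I * (2 * Real.pi / s) * (k : ℕ) * f) *
        star (Complex.exp (-Complex.I * (2 * Real.pi / s) * (l : ℕ) * f)) := by
    intro f
    simp only [Complex.star_def, ← Complex.exp_conj, ← Complex.exp_add, epoch_val, map_mul,
      map_neg, map_div₀, Complex.conj_I, Complex.conj_ofReal, map_natCast, map_ofNat]
    congr 1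
    rw [hN]
    push_cast
    field_simp
    ring
  -- As `s ≤ N`, the cutoff leaves exactly the frequencies `0, …, s - 1`, over which the `s`-point
  -- characters are orthogonal.
  have hsum : ∑ f : Fin N, (if (f : ℕ) < s then
      Complex.exp (-Complex.I * (2 * Real.pi / s) * (k : ℕ) * (f : ℕ)) *
        star (Complex.exp (-Complex.I * (2 * Real.pi / s) * (l : ℕ) * (f : ℕ))) else 0) =
      if (k : ℕ) = l then (s : ℂ) else 0 := by
    rw [← sum_exp_mul_star_exp k.2 l.2, ← Finset.sum_range (fun f : ℕ => if f < s then
      Complex.exp (-Complex.I * (2 * Real.pi / s) * (k : ℕ) * f) *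
        star (Complex.exp (-Complex.I * (2 * Real.pi / s) * (l : ℕ) * f)) else 0),
      ← Finset.sum_filter]
    congr 1
    ext f
    simp only [Finset.mem_filter, Finset.mem_range]
    omega
  have hexp : K (epoch hN k td) (epoch hN l td) = ((Px / s : ℝ) : ℂ) * (1 / N) *
      ∑ f : Fin N, (if (f : ℕ) < s then
      Complex.exp (-Complex.I * (2 * Real.pi / s) * (k : ℕ) * (f : ℕ)) *
        star (Complex.exp (-Complex.I * (2 * Real.pi / s) * (l : ℕ) * (f : ℕ))) else 0) := by
    conv_lhs => rw [hK.eq_mul_diagonal_mul]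
    rw [Matrix.mul_apply, Finset.mul_sum]
    refine Finset.sum_congr rfl fun f _ => ?_
    rw [Matrix.mul_diagonal, Matrix.conjTranspose_apply, mul_right_comm, dftMatrix_mul_star,
      hphase]
    split_ifs <;> ring
  rw [hexp, hsum]
  simp only [Fin.val_inj]
  split_ifs
  · push_cast
    field_simp
  · simp

end

/-! ### Mean-square errors -/

theorem norm_toLp_sq_eq_integral {Ω E : Type*} [MeasurableSpace Ω] {P : Measure Ω}
    [NormedAddCommGroup E] [InnerProductSpace ℂ E] {f : Ω → E} (hf : MemLp f 2 P) :
    ‖hf.toLp f‖ ^ 2 = ∫ ω, ‖f ω‖ ^ 2 ∂P := by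
  have h : ((‖hf.toLp f‖ ^ 2 : ℝ) : ℂ) = ((∫ ω, ‖f ω‖ ^ 2 ∂P : ℝ) : ℂ) := by
    have h1 := inner_self_eq_norm_sq_to_K (𝕜 := ℂ) (hf.toLp f)
    rw [L2.inner_def] at h1
    rw [Complex.ofReal_pow]
    refine h1.symm.trans ?_
    rw [← integral_complex_ofReal]
    refine integral_congr_ae ?_
    filter_upwards [hf.coeFn_toLp] with ω hω
    rw [hω, inner_self_eq_norm_sq_to_K]
    simp
  exact_mod_cast h

/-- The conditional expectation minimizes the mean-square error among all square-integrable
estimators that are measurable with respect to the given σ-algebra. -/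
theorem integral_norm_sub_condExp_sq_le {Ω E : Type*} {m m0 : MeasurableSpace Ω} {P : Measure Ω}
    [IsFiniteMeasure P] [NormedAddCommGroup E] [InnerProductSpace ℂ E] [NormedSpace ℝ E]
    [CompleteSpace E] (hm : m ≤ m0) {f g : Ω → E} (hf : MemLp f 2 P) (hg : MemLp g 2 P)
    (hgm : AEStronglyMeasurable[m] g P) :
    ∫ ω, ‖f ω - (P[f | m]) ω‖ ^ 2 ∂P ≤ ∫ ω, ‖f ω - g ω‖ ^ 2 ∂P := by
  have : Fact (m ≤ m0) := ⟨hm⟩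
  have hG : hg.toLp g ∈ lpMeas E ℂ m 2 P := by
    rw [mem_lpMeas_iff_aestronglyMeasurable]
    exact hgm.congr hg.coeFn_toLp.symm
  set pr : Lp E 2 P := (condExpL2 E ℂ hm (hf.toLp f) : Lp E 2 P) with hpr
  have hprm : MemLp pr 2 P := Lp.memLp _
  have hae : pr =ᵐ[P] P[f | m] := hf.condExpL2_ae_eq_condExp (𝕜 := ℂ) hm
  have hle : ‖hf.toLp f - pr‖ ≤ ‖hf.toLp f - hg.toLp g‖ := by
    have hmin := Submodule.starProjection_minimal (U := lpMeas E ℂ m 2 P) (hf.toLp f)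
    have hle' : ⨅ z : lpMeas E ℂ m 2 P, ‖hf.toLp f - z‖ ≤ ‖hf.toLp f - hg.toLp g‖ :=
      ciInf_le ⟨0, by rintro _ ⟨z, rfl⟩; exact norm_nonneg _⟩
        (⟨hg.toLp g, hG⟩ : lpMeas E ℂ m 2 P)
    exact hmin.le.trans hle'
  have h1 : ‖hf.toLp f - pr‖ ^ 2 = ∫ ω, ‖f ω - (P[f | m]) ω‖ ^ 2 ∂P := by
    have : hf.toLp f - pr = (hf.sub hprm).toLp _ := by
      rw [MemLp.toLp_sub hf hprm, Lp.toLp_coeFn]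
    rw [this, norm_toLp_sq_eq_integral]
    refine integral_congr_ae ?_
    filter_upwards [hae] with ω hω
    rw [Pi.sub_apply, hω]
  have h2 : ‖hf.toLp f - hg.toLp g‖ ^ 2 = ∫ ω, ‖f ω - g ω‖ ^ 2 ∂P := by
    rw [← MemLp.toLp_sub hf hg, norm_toLp_sq_eq_integral]
    rfl
  rw [← h1, ← h2]
  gcongr

theorem MeasureTheory.MemLp.integrable_mul_star {Ω : Type*} [MeasurableSpace Ω] {P : Measure Ω}
    {a b : Ω → ℂ} (ha : MemLp a 2 P) (hb : MemLp b 2 P) :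
    Integrable (fun ω => a ω * star (b ω)) P :=
  MemLp.integrable_mul ha hb.star

/-- The mean-square error of a linear estimator from uncorrelated observations. -/
theorem integral_norm_sub_sum_sq {Ω ι : Type*} [MeasurableSpace Ω] {P : Measure Ω}
    [Fintype ι] [DecidableEq ι] {a : Ω → ℂ} {y : ι → Ω → ℂ} (ha : MemLp a 2 P)
    (hy : ∀ k, MemLp (y k) 2 P) {α : ℂ} {c v : ι → ℂ}
    (haa : ∫ ω, a ω * star (a ω) ∂P = α) (hay : ∀ k, ∫ ω, a ω * star (y k ω) ∂P = c k)
    (hyy : ∀ k l, ∫ ω, y k ω * star (y l ω) ∂P = if k = l then v k else 0) (b : ι → ℂ) :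
    ((∫ ω, ‖a ω - ∑ k, b k * y k ω‖ ^ 2 ∂P : ℝ) : ℂ) =
      α - ∑ k, star (b k) * c k - ∑ k, b k * star (c k) + ∑ k, b k * star (b k) * v k := by
  have hexp : ∀ ω, ((‖a ω - ∑ k, b k * y k ω‖ ^ 2 : ℝ) : ℂ) =
      a ω * star (a ω) - ∑ k, star (b k) * (a ω * star (y k ω))
        - ∑ k, b k * star (a ω * star (y k ω))
        + ∑ k, ∑ l, b k * star (b l) * (y k ω * star (y l ω)) := by
    intro ω
    rw [Complex.ofReal_pow, ← Complex.mul_conj', ← Complex.star_def, star_sub, star_sum]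
    simp only [star_mul', star_star]
    have h1 : ∑ k, star (b k) * (a ω * star (y k ω)) = a ω * ∑ k, star (b k) * star (y k ω) := by
      rw [Finset.mul_sum]; exact Finset.sum_congr rfl fun k _ => by ring
    have h2 : ∑ k, b k * (star (a ω) * y k ω) = (∑ k, b k * y k ω) * star (a ω) := by
      rw [Finset.sum_mul]; exact Finset.sum_congr rfl fun k _ => by ring
    have h3 : ∑ k, ∑ l, b k * star (b l) * (y k ω * star (y l ω)) =
        (∑ k, b k * y k ω) * ∑ k, star (b k) * star (y k ω) := by
      rw [Finset.sum_mul_sum]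
      exact Finset.sum_congr rfl fun k _ => Finset.sum_congr rfl fun l _ => by ring
    rw [h1, h2, h3]
    ring
  have hI1 : Integrable (fun ω => a ω * star (a ω)) P := ha.integrable_mul_star ha
  have hI2 : ∀ k, Integrable (fun ω => star (b k) * (a ω * star (y k ω))) P :=
    fun k => (ha.integrable_mul_star (hy k)).const_mul _
  have hI3 : ∀ k, Integrable (fun ω => b k * star (a ω * star (y k ω))) P := by
    intro k
    simp only [star_mul', star_star]
    refine (((hy k).integrable_mul_star ha).const_mul (b k)).congr (ae_of_all _ fun ω => ?_)
    simp only
    ring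
  have hI4 : ∀ k l, Integrable (fun ω => b k * star (b l) * (y k ω * star (y l ω))) P :=
    fun k l => ((hy k).integrable_mul_star (hy l)).const_mul _
  have hS2 := integrable_finsetSum Finset.univ fun k _ => hI2 k
  have hS3 := integrable_finsetSum Finset.univ fun k _ => hI3 k
  have hS4 := integrable_finsetSum Finset.univ fun k _ =>
    integrable_finsetSum Finset.univ fun l _ => hI4 k l
  have hD2 : Integrable (fun ω => a ω * star (a ω) - ∑ k, star (b k) * (a ω * star (y k ω))) P :=
    hI1.sub hS2
  have hD3 : Integrable (fun ω => a ω * star (a ω) - ∑ k, star (b k) * (a ω * star (y k ω))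
      - ∑ k, b k * star (a ω * star (y k ω))) P := hD2.sub hS3
  rw [← integral_complex_ofReal]
  simp only [hexp]
  rw [integral_add hD3 hS4, integral_sub hD2 hS3, integral_sub hI1 hS2, integral_finsetSum _ fun k _ => hI2 k,
    integral_finsetSum _ fun k _ => hI3 k, integral_finsetSum _ fun k _ =>
      integrable_finsetSum Finset.univ fun l _ => hI4 k l]
  congr 1
  · congr 1
    · congr 1
      exact Finset.sum_congr rfl fun k _ => by rw [integral_const_mul, hay]
    · refine Finset.sum_congr rfl fun k _ => ?_
      rw [integral_const_mul, ← hay]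
      congr 1
      exact integral_conj
  · refine Finset.sum_congr rfl fun k _ => ?_
    rw [integral_finsetSum _ fun l _ => hI4 k l]
    simp only [integral_const_mul, hyy]
    simp

/-! ### Second moments of the received signal -/

section

variable {Ω : Type*} [MeasurableSpace Ω] {P : Measure Ω}

theorem IsProperGaussian.memLp_apply {ι : Type*} [Fintype ι] {X : Ω → EuclideanSpace ℂ ι}
    {K : Matrix ι ι ℂ} (hX : IsProperGaussian X K P) (i : ι) : MemLp (fun ω => X ω i) 2 P :=
  hX.gaussian.memLp_two.eval_piLp i

theorem IsProperGaussian.integral_mul_star_eq_zero {ι κ : Type*} [Fintype ι] [Fintype κ]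
    {X : Ω → EuclideanSpace ℂ ι} {Y : Ω → EuclideanSpace ℂ κ} {K : Matrix ι ι ℂ}
    (hX : IsProperGaussian X K P) (hY : Measurable Y) (hXY : IndepFun X Y P) (i : ι) (j : κ) :
    ∫ ω, X ω i * star (Y ω j) ∂P = 0 := by
  have h := hXY.integral_fun_comp_mul_comp (f := fun v : EuclideanSpace ℂ ι => v i)
    (g := fun v : EuclideanSpace ℂ κ => star (v j)) hX.measurable.aemeasurable hY.aemeasurable
    (Continuous.aestronglyMeasurable (by fun_prop)) (Continuous.aestronglyMeasurable (by fun_prop))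
  rw [h, hX.mean_zero, zero_mul]

theorem integral_star_comm {a b : Ω → ℂ} :
    ∫ ω, b ω * star (a ω) ∂P = star (∫ ω, a ω * star (b ω) ∂P) := by
  have h : ∫ ω, star (a ω * star (b ω)) ∂P = star (∫ ω, a ω * star (b ω) ∂P) := integral_conj
  rw [← h]
  simp only [star_mul', star_star]
  exact integral_congr_ae (ae_of_all _ fun ω => mul_comm _ _)

variable {N s Q : ℕ} (hN : N = s * Q) (td : Fin Q) {x : Ω → EuclideanSpace ℂ (Fin N)}
  {w : Ω → EuclideanSpace ℂ (Fin s)} {K : Matrix (Fin N) (Fin N) ℂ} {Px σw : ℝ}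

theorem memLp_received_apply (hx : IsProperGaussian x K P)
    (hw : IsProperGaussian w (((σw ^ 2 : ℝ) : ℂ) • (1 : Matrix (Fin s) (Fin s) ℂ)) P)
    (p : Fin s → ℝ) (k : Fin s) : MemLp (fun ω => received hN td x w p ω k) 2 P :=
  ((hx.memLp_apply (epoch hN k td)).const_mul _).add (hw.memLp_apply k)

theorem integral_mul_star_received (hx : IsProperGaussian x K P)
    (hw : IsProperGaussian w (((σw ^ 2 : ℝ) : ℂ) • (1 : Matrix (Fin s) (Fin s) ℂ)) P)
    (hxw : IndepFun x w P) (p : Fin s → ℝ) (t : Fin N) (k : Fin s) :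
    ∫ ω, x ω t * star (received hN td x w p ω k) ∂P =
      (Real.sqrt (p k) : ℂ) * K t (epoch hN k td) := by
  have hexp : ∀ ω, x ω t * star (received hN td x w p ω k) =
      (Real.sqrt (p k) : ℂ) * (x ω t * star (x ω (epoch hN k td))) + x ω t * star (w ω k) := by
    intro ω
    simp only [received, star_add, star_mul', Complex.star_def, Complex.conj_ofReal]
    ring
  simp only [hexp]
  rw [integral_add (((hx.memLp_apply t).integrable_mul_star (hx.memLp_apply _)).const_mul _)
    ((hx.memLp_apply t).integrable_mul_star (hw.memLp_apply k)), integral_const_mul,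
    hx.covariance, hx.integral_mul_star_eq_zero hw.measurable hxw, add_zero]

theorem integral_received_mul_star (hK : IsLowPassCWSS s Px K) (hx : IsProperGaussian x K P)
    (hw : IsProperGaussian w (((σw ^ 2 : ℝ) : ℂ) • (1 : Matrix (Fin s) (Fin s) ℂ)) P)
    (hxw : IndepFun x w P) {p : Fin s → ℝ} (hp : ∀ k, 0 ≤ p k) (k l : Fin s) :
    ∫ ω, received hN td x w p ω k * star (received hN td x w p ω l) ∂P =
      if k = l then ((p k * (Px / N) + σw ^ 2 : ℝ) : ℂ) else 0 := by
  have hy := memLp_received_apply hN td hx hw p l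
  -- In the signal term only the first factor is expanded, so that `integral_mul_star_received`
  -- evaluates it.
  have hexp : ∀ ω, received hN td x w p ω k * star (received hN td x w p ω l) =
      (Real.sqrt (p k) : ℂ) * (x ω (epoch hN k td) * star (received hN td x w p ω l)) +
        ((Real.sqrt (p l) : ℂ) * (w ω k * star (x ω (epoch hN l td))) +
          w ω k * star (w ω l)) := by
    intro ω
    simp only [received, star_add, star_mul', Complex.star_def, Complex.conj_ofReal]
    ring
  have hwx : ∫ ω, w ω k * star (x ω (epoch hN l td)) ∂P = 0 := by
    rw [integral_star_comm, hx.integral_mul_star_eq_zero hw.measurable hxw, star_zero]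
  have hI1 := ((hw.memLp_apply k).integrable_mul_star
    (hx.memLp_apply (epoch hN l td))).const_mul (Real.sqrt (p l) : ℂ)
  have hI2 := (hw.memLp_apply k).integrable_mul_star (hw.memLp_apply l)
  have hI3 : Integrable (fun ω => (Real.sqrt (p l) : ℂ) * (w ω k * star (x ω (epoch hN l td))) +
      w ω k * star (w ω l)) P := hI1.add hI2
  simp only [hexp]
  rw [integral_add (((hx.memLp_apply _).integrable_mul_star hy).const_mul _) hI3,
    integral_add hI1 hI2, integral_const_mul, integral_const_mul, hwx, hw.covariance,
    integral_mul_star_received hN td hx hw hxw, hK.apply_epoch]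
  by_cases h : k = l
  · subst h
    have hs : (Real.sqrt (p k) : ℂ) * (Real.sqrt (p k) : ℂ) = (p k : ℂ) := by
      rw [← Complex.ofReal_mul, Real.mul_self_sqrt (hp k)]
    simp only [if_true, ← mul_assoc, hs]
    simp
  · simp [h]

theorem usedEnergy_eq (hK : IsLowPassCWSS s Px K) (hx : IsProperGaussian x K P) (k : Fin s)
    {p : ℝ} (hp : 0 ≤ p) : usedEnergy P hN td x k p = p * (Px / N) := by
  have h : ((∫ ω, ‖x ω (epoch hN k td)‖ ^ 2 ∂P : ℝ) : ℂ) = ((Px / N : ℝ) : ℂ) := by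
    have h1 := hx.covariance (epoch hN k td) (epoch hN k td)
    rw [hK.apply_epoch, if_pos rfl] at h1
    rw [← h1, ← integral_complex_ofReal]
    refine integral_congr_ae (ae_of_all _ fun ω => ?_)
    simp only [Complex.star_def, Complex.mul_conj', Complex.ofReal_pow]
  simp only [usedEnergy, norm_mul, mul_pow, Complex.norm_real, Real.norm_eq_abs, sq_abs,
    Real.sq_sqrt hp]
  rw [integral_const_mul, Complex.ofReal_inj.1 h]

/-- The error of the best linear estimator bounds the minimum mean-square error. -/
theorem mmse_received_le [IsFiniteMeasure P] (hK : IsLowPassCWSS s Px K) (hx : IsProperGaussian x K P)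
    (hσw : 0 < σw) (hPx : 0 < Px)
    (hw : IsProperGaussian w (((σw ^ 2 : ℝ) : ℂ) • (1 : Matrix (Fin s) (Fin s) ℂ)) P)
    (hxw : IndepFun x w P) {p : Fin s → ℝ} (hp : ∀ k, 0 ≤ p k) :
    mmse P x (received hN td x w p) ≤
      ∑ k, Px / s * (1 / (1 + 1 / σw ^ 2 * (p k * (Px / N)))) := by
  have hs : (s : ℝ) ≠ 0 := Nat.cast_ne_zero.2 (hK.pos hN hPx).ne'
  have hQ : (Q : ℝ) ≠ 0 := Nat.cast_ne_zero.2 (by have := td.2; omega)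
  have hNR : (N : ℝ) = s * Q := by rw [hN]; push_cast; ring
  set v : Fin s → ℝ := fun k => p k * (Px / N) + σw ^ 2 with hv
  have hv0 : ∀ k, 0 < v k := fun k => by
    have := hp k
    positivity
  -- The linear MMSE weights for uncorrelated observations: `B t k` is `E[x_t * star y_k]` divided
  -- by `v k`, the variance of `y_k`.
  set b : Fin s → ℝ := fun k => Real.sqrt (p k) / v k with hb
  set B : Fin N → Fin s → ℂ := fun t k => (b k : ℂ) * K t (epoch hN k td) with hB
  set y := received hN td x w p with hy
  have hyL := memLp_received_apply hN td hx hw p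
  have hym : Measurable y := by
    have h1 := hx.measurable
    have h2 := hw.measurable
    rw [hy]
    unfold received
    fun_prop
  set g : Ω → EuclideanSpace ℂ (Fin N) := fun ω => WithLp.toLp 2 fun t => ∑ k, B t k * y ω k
    with hg
  have hgL : MemLp g 2 P := by
    refine MemLp.of_eval_piLp fun t => ?_
    exact memLp_finsetSum Finset.univ fun k _ => (hyL k).const_mul (B t k)
  have hgm : StronglyMeasurable[MeasurableSpace.comap y inferInstance] g := by
    have hc : Continuous fun u : EuclideanSpace ℂ (Fin s) =>
        (WithLp.toLp 2 fun t => ∑ k, B t k * u k : EuclideanSpace ℂ (Fin N)) := by fun_prop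
    exact hc.stronglyMeasurable.comp_measurable (comap_measurable y)
  have hle : mmse P x y ≤ ∫ ω, ‖x ω - g ω‖ ^ 2 ∂P :=
    integral_norm_sub_condExp_sq_le hym.comap_le hx.gaussian.memLp_two hgL
      hgm.aestronglyMeasurable
  refine hle.trans (le_of_eq ?_)
  have hcol : ∀ k, ∑ t, K t (epoch hN k td) * star (K t (epoch hN k td)) =
      ((Px / s * (Px / N) : ℝ) : ℂ) := by
    intro k
    have h1 := congrFun (congrFun hK.mul_self (epoch hN k td)) (epoch hN k td)
    rw [Matrix.mul_apply, Matrix.smul_apply, hK.apply_epoch, if_pos rfl, smul_eq_mul,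
      ← Complex.ofReal_mul] at h1
    rw [← h1]
    refine Finset.sum_congr rfl fun t _ => ?_
    rw [hK.isHermitian.apply, mul_comm]
  have hsplit : ∫ ω, ‖x ω - g ω‖ ^ 2 ∂P = ∑ t, ∫ ω, ‖x ω t - ∑ k, B t k * y ω k‖ ^ 2 ∂P := by
    rw [← integral_finsetSum]
    · refine integral_congr_ae (ae_of_all _ fun ω => ?_)
      simp only [EuclideanSpace.norm_sq_eq]
      rfl
    · intro t _
      exact ((hx.memLp_apply t).sub
        (memLp_finsetSum _ fun k _ => (hyL k).const_mul (B t k))).integrable_norm_pow (by simp)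
  have hcomplex : ((∫ ω, ‖x ω - g ω‖ ^ 2 ∂P : ℝ) : ℂ) =
      ((Px - ∑ k, Px / s * (Px / N) * (2 * b k * Real.sqrt (p k) - b k ^ 2 * v k) : ℝ) : ℂ) := by
    rw [hsplit, Complex.ofReal_sum]
    have hterm : ∀ t, ((∫ ω, ‖x ω t - ∑ k, B t k * y ω k‖ ^ 2 ∂P : ℝ) : ℂ) =
        K t t - ∑ k, ((2 * b k * Real.sqrt (p k) - b k ^ 2 * v k : ℝ) : ℂ) *
          (K t (epoch hN k td) * star (K t (epoch hN k td))) := by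
      intro t
      rw [integral_norm_sub_sum_sq (hx.memLp_apply t) hyL (hx.covariance t t)
        (integral_mul_star_received hN td hx hw hxw p t)
        (integral_received_mul_star hN td hK hx hw hxw hp) (B t), sub_sub, ← Finset.sum_add_distrib,
        sub_add, ← Finset.sum_sub_distrib]
      congr 1
      refine Finset.sum_congr rfl fun k _ => ?_
      simp only [hB, hv, star_mul', Complex.star_def, Complex.conj_ofReal]
      push_cast
      ring
    simp only [hterm]
    rw [Finset.sum_sub_distrib, Finset.sum_comm]
    simp only [← Finset.mul_sum, hcol]
    have htr : ∑ t, K t t = (Px : ℂ) := hK.trace_eq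
    rw [htr]
    push_cast
    rw [← Finset.sum_mul, mul_comm]
  rw [Complex.ofReal_inj.1 hcomplex]
  have hPsum : Px = ∑ _k : Fin s, Px / s := by
    rw [Finset.sum_const, Finset.card_univ, Fintype.card_fin, nsmul_eq_mul]
    field_simp
  calc Px - ∑ k, Px / s * (Px / N) * (2 * b k * Real.sqrt (p k) - b k ^ 2 * v k)
      = (∑ _k : Fin s, Px / s) -
          ∑ k, Px / s * (Px / N) * (2 * b k * Real.sqrt (p k) - b k ^ 2 * v k) := by rw [← hPsum]
    _ = _ := by
      rw [← Finset.sum_sub_distrib]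
      refine Finset.sum_congr rfl fun k _ => ?_
      have hvk := (hv0 k).ne'
      -- The value at the maximizer of this quadratic in `b k`.
      have h1 : 2 * b k * Real.sqrt (p k) - b k ^ 2 * v k = p k / v k := by
        simp only [hb]
        field_simp
        rw [Real.sq_sqrt (hp k)]
        ring
      have h2 : 1 + 1 / σw ^ 2 * (p k * (Px / N)) = v k / σw ^ 2 := by
        simp only [hv]
        rw [add_div, div_self (by positivity)]
        ring
      have h3 : σw ^ 2 = v k - p k * (Px / N) := by simp only [hv]; ring
      rw [h1, h2, one_div_div, h3]
      generalize v k = u at hvk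
      field_simp

end

/-! ### Energy collected in a slot -/

theorem epoch_injective {N s Q : ℕ} (hN : N = s * Q) (k : Fin s) :
    Function.Injective (epoch hN k) := by
  intro t t' h
  have h' : (epoch hN k t : ℕ) = epoch hN k t' := by rw [h]
  simp only [epoch_val] at h'
  exact Fin.ext (by omega)

section

variable {Ω : Type*} [MeasurableSpace Ω] {P : Measure Ω} [IsProbabilityMeasure P]
  {N s Q : ℕ} (hN : N = s * Q) {E : Fin N → Ω → ℝ} {μE ϱE Emax r : ℝ}

theorem memLp_two_of_ae_nonneg_le {X : Ω → ℝ} {b : ℝ} (hX : Measurable X)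
    (hb : ∀ᵐ ω ∂P, 0 ≤ X ω ∧ X ω ≤ b) : MemLp X 2 P := by
  refine MemLp.of_bound hX.aestronglyMeasurable b ?_
  filter_upwards [hb] with ω hω
  rw [Real.norm_eq_abs, abs_of_nonneg hω.1]
  exact hω.2

/-- Lower tail of the energy of a slot when the arrivals have positive variance. -/
theorem measure_slotEnergy_le_le (hQ : 0 < Q) (k : Fin s) (hEm : ∀ t, Measurable (E t))
    (hEind : iIndepFun E P) (hμE : 0 < μE) (hEbd : ∀ t, ∀ᵐ ω ∂P, 0 ≤ E t ω ∧ E t ω ≤ Emax)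
    (hEmean : ∀ t, ∫ ω, E t ω ∂P = μE) (hEvar : ∀ t, variance (E t) P = ϱE) (hϱE : 0 < ϱE)
    {b : ℝ} (hb : 1 ≤ b) (hr : 0 < r) :
    P.real {ω | slotEnergy hN (fun t => E t ω) k ≤ μE * Q * (1 - r)} ≤
      Real.exp (-(ϱE / μE ^ 2 * ((s : ℝ) / N) / b ^ 2) *
        bennettH (b * r / (ϱE / μE ^ 2 * ((s : ℝ) / N)))) := by
  have hs : (0 : ℝ) < s := Nat.cast_pos.2 (by have := k.2; omega)
  have hQR : (0 : ℝ) < Q := Nat.cast_pos.2 hQ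
  have hQ1 : (1 : ℝ) ≤ Q := by exact_mod_cast hQ
  have hNR : (N : ℝ) = s * Q := by rw [hN]; push_cast; ring
  have hEL : ∀ t, MemLp (E t) 2 P := fun t =>
    memLp_two_of_ae_nonneg_le (hEm t) (hEbd t)
  set c : ℝ := (μE * Q)⁻¹ with hc
  have hc0 : 0 < c := by positivity
  -- Scaled so that the slot falls short by the fraction `r` exactly when `r ≤ ∑ t, X t`.
  -- Nonnegativity of the arrivals gives `X t ≤ 1 / Q ≤ 1 ≤ b`.
  set X : Fin Q → Ω → ℝ := fun t ω => c * (μE - E (epoch hN k t) ω) with hX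
  have hind : iIndepFun X P :=
    (hEind.precomp (epoch_injective hN k)).comp (fun _ e => c * (μE - e)) fun _ => by fun_prop
  have hXL : ∀ t, MemLp (X t) 2 P := fun t =>
    ((memLp_const μE).sub (hEL (epoch hN k t))).const_mul c
  have hXb : ∀ t, ∀ᵐ ω ∂P, X t ω ≤ b := fun t => by
    filter_upwards [hEbd (epoch hN k t)] with ω hω
    calc X t ω ≤ c * μE := by
          refine mul_le_mul_of_nonneg_left ?_ hc0.le
          linarith [hω.1]
      _ = 1 / Q := by rw [hc]; field_simp
      _ ≤ 1 := by rw [div_le_one hQR]; exact hQ1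
      _ ≤ b := hb
  have hXmean : ∀ t, ∫ ω, X t ω ∂P = 0 := fun t => by
    simp only [hX]
    rw [integral_const_mul, integral_sub (integrable_const _)
      ((hEL (epoch hN k t)).integrable one_le_two), hEmean]
    simp
  have hXvar : ∀ t, variance (X t) P = c ^ 2 * ϱE := fun t => by
    simp only [hX]
    rw [variance_const_mul, variance_const_sub (hEm _).aestronglyMeasurable, hEvar]
  have hV : ∑ t, variance (X t) P = ϱE / μE ^ 2 * ((s : ℝ) / N) := by
    simp only [hXvar, Finset.sum_const, Finset.card_univ, Fintype.card_fin, nsmul_eq_mul]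
    rw [hc, hNR]
    field_simp
  have hset : {ω | slotEnergy hN (fun t => E t ω) k ≤ μE * Q * (1 - r)} =
      {ω | r ≤ ∑ t, X t ω} := by
    ext ω
    simp only [Set.mem_ofPred_eq, hX, ← Finset.mul_sum, Finset.sum_sub_distrib, Finset.sum_const,
      Finset.card_univ, Fintype.card_fin, nsmul_eq_mul, slotEnergy]
    rw [hc, inv_mul_eq_div, le_div_iff₀ (by positivity)]
    constructor <;> intro h <;> linarith
  rw [hset]
  refine bennett_inequality hind hXL hXb (by linarith) hXmean hV ?_ hr
  rw [hNR]
  positivity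

/-- Zero variance makes every arrival almost surely `μE`, so the slot collects `μE * Q`. This
matches the value `0` of `fbt` at zero variance. -/
theorem measure_slotEnergy_le_eq_zero (hQ : 0 < Q) (k : Fin s) (hEm : ∀ t, Measurable (E t))
    (hμE : 0 < μE) (hEbd : ∀ t, ∀ᵐ ω ∂P, 0 ≤ E t ω ∧ E t ω ≤ Emax)
    (hEmean : ∀ t, ∫ ω, E t ω ∂P = μE) (hEvar : ∀ t, variance (E t) P = 0) (hr : 0 < r) :
    P.real {ω | slotEnergy hN (fun t => E t ω) k ≤ μE * Q * (1 - r)} = 0 := by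
  have hQR : (0 : ℝ) < Q := Nat.cast_pos.2 hQ
  have hconst : ∀ t, ∀ᵐ ω ∂P, E t ω = μE := fun t => by
    have hEL : MemLp (E t) 2 P := memLp_two_of_ae_nonneg_le (hEm t) (hEbd t)
    have h := hEL.ofReal_variance_eq
    rw [hEvar t, ENNReal.ofReal_zero, eq_comm, evariance_eq_zero_iff (hEm t).aemeasurable] at h
    filter_upwards [h] with ω hω
    rw [hω, hEmean]
  rw [measureReal_def, ENNReal.toReal_eq_zero_iff]
  left
  rw [measure_eq_zero_iff_ae_notMem]
  filter_upwards [ae_all_iff.2 hconst] with ω hω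
  simp only [slotEnergy, hω, Finset.sum_const, Finset.card_univ,
    Fintype.card_fin, nsmul_eq_mul, not_le]
  have : 0 < μE * Q * r := by positivity
  linarith

end

/-! ### Union bound over the slots -/

theorem theorem4p1
    -- dimensions: `N` epochs, `s` degrees of freedom, `Q = N / s`, fixed initial delay `td`
    {N s Q : ℕ} (hN : N = s * Q) (td : Fin Q)
    -- signal and channel noise
    {ΩS : Type*} [MeasurableSpace ΩS] (PS : Measure ΩS) [IsProbabilityMeasure PS]
    (x : ΩS → EuclideanSpace ℂ (Fin N)) (w : ΩS → EuclideanSpace ℂ (Fin s))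
    (K : Matrix (Fin N) (Fin N) ℂ) (Px : ℝ) (hPx : 0 < Px)
    (hK : IsLowPassCWSS s Px K) (hx : IsProperGaussian x K PS)
    (σw : ℝ) (hσw : 0 < σw)
    (hw : IsProperGaussian w (((σw ^ 2 : ℝ) : ℂ) • (1 : Matrix (Fin s) (Fin s) ℂ)) PS)
    (hxw : IndepFun x w PS)
    -- i.i.d. bounded energy arrivals
    {ΩE : Type*} [MeasurableSpace ΩE] (PE : Measure ΩE) [IsProbabilityMeasure PE]
    (E : Fin N → ΩE → ℝ) (hEm : ∀ t, Measurable (E t)) (hEind : iIndepFun E PE)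
    (hEid : ∀ t t', IdentDistrib (E t) (E t') PE PE)
    (μE ϱE Emax rE : ℝ) (hμE : 0 < μE) (hEmax : Emax = rE * μE)
    (hEbd : ∀ t, ∀ᵐ ω ∂PE, 0 ≤ E t ω ∧ E t ω ≤ Emax)
    (hEmean : ∀ t, ∫ ω, E t ω ∂PE = μE) (hEvar : ∀ t, variance (E t) PE = ϱE)
    -- amplification factors: all the energy stored during a slot is used at its end
    (p : Fin s → ΩE → ℝ)
    (hp : ∀ k, ∀ᵐ ω ∂PE, 0 ≤ p k ω ∧
      usedEnergy PS hN td x k (p k ω) = slotEnergy hN (fun t => E t ω) k)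
    (r : ℝ) (hr : r ∈ Set.Ioo (0 : ℝ) 1) :
    1 - fbt s (max (rE - 1) 1) (ϱE / μE ^ 2 * ((s : ℝ) / N)) r ≤
        PE.real {ω | mmse PS x (received hN td x w (fun k => p k ω)) <
          1 / (1 + 1 / σw ^ 2 * μE * ((N : ℝ) / s) * (1 - r)) * Px} ∧
      1 - fbn s (max (rE - 1) 1) (ϱE / μE ^ 2 * ((s : ℝ) / N)) r ≤
        1 - fbt s (max (rE - 1) 1) (ϱE / μE ^ 2 * ((s : ℝ) / N)) r := by
  obtain ⟨hr0, hr1⟩ := hr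
  have hQ : 0 < Q := by have := td.2; omega
  have hs : 0 < s := hK.pos hN hPx
  have hsR : (0 : ℝ) < s := Nat.cast_pos.2 hs
  have hQR : (0 : ℝ) < Q := Nat.cast_pos.2 hQ
  have hNR : (N : ℝ) = s * Q := by rw [hN]; push_cast; ring
  have hNs : (N : ℝ) / s = Q := by rw [hNR]; field_simp
  have hϱ0 : 0 ≤ ϱE := by
    rw [← hEvar (epoch hN ⟨0, hs⟩ td)]
    exact variance_nonneg _ _
  have hb1 : 1 ≤ max (rE - 1) 1 := le_max_right _ _
  refine ⟨?_, sub_le_sub_left (fbt_le_fbn s (by linarith) (by positivity) hr0) 1⟩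
  set ϱ := ϱE / μE ^ 2 * ((s : ℝ) / N) with hϱ
  set b := max (rE - 1) 1
  set A : Fin s → Set ΩE := fun k => {ω | slotEnergy hN (fun t => E t ω) k ≤ μE * Q * (1 - r)}
    with hA
  have hAm : ∀ k, MeasurableSet (A k) := fun k => by
    refine measurableSet_le ?_ measurable_const
    unfold slotEnergy
    fun_prop
  have htail : ∑ k, PE.real (A k) ≤ fbt s b ϱ r := by
    unfold fbt
    split_ifs with h
    · have hϱE : ϱE = 0 := by
        by_contra hne
        refine absurd h (ne_of_gt ?_)
        have := lt_of_le_of_ne hϱ0 (Ne.symm hne)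
        rw [hϱ, hNR]
        positivity
      refine (Finset.sum_eq_zero fun k _ => ?_).le
      exact measure_slotEnergy_le_eq_zero hN hQ k hEm hμE hEbd hEmean
        (fun t => (hEvar t).trans hϱE) hr0
    · have hϱE : 0 < ϱE := by
        refine lt_of_le_of_ne hϱ0 fun h0 => h ?_
        rw [hϱ, ← h0]
        simp
      calc ∑ k, PE.real (A k)
          ≤ ∑ _k : Fin s, Real.exp (-(ϱ / b ^ 2) * bennettH (b * r / ϱ)) :=
            Finset.sum_le_sum fun k _ => measure_slotEnergy_le_le hN hQ k hEm hEind hμE hEbd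
              hEmean hEvar hϱE hb1 hr0
        _ = s * Real.exp (-(ϱ / b ^ 2) * bennettH (b * r / ϱ)) := by
            rw [Finset.sum_const, Finset.card_univ, Fintype.card_fin, nsmul_eq_mul]
        -- Only lower tails occur, so the factor `2` in `fbt` is slack.
        _ ≤ _ := by
            refine mul_le_mul_of_nonneg_right ?_ (Real.exp_pos _).le
            linarith
  have hgood : ∀ᵐ ω ∂PE, ω ∈ (⋃ k, A k)ᶜ →
      ω ∈ {ω | mmse PS x (received hN td x w (fun k => p k ω)) <
          1 / (1 + 1 / σw ^ 2 * μE * ((N : ℝ) / s) * (1 - r)) * Px} := by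
    filter_upwards [ae_all_iff.2 hp] with ω hpω hω
    simp only [hA, Set.mem_compl_iff, Set.mem_iUnion, Set.mem_ofPred_eq, not_exists, not_le] at hω
    have hle := mmse_received_le hN td hK hx hσw hPx hw hxw (p := fun k => p k ω)
      fun k => (hpω k).1
    refine hle.trans_lt ?_
    have hr' : 0 < 1 - r := by linarith
    calc ∑ k, Px / s * (1 / (1 + 1 / σw ^ 2 * (p k ω * (Px / N))))
        < ∑ _k : Fin s, Px / s * (1 / (1 + 1 / σw ^ 2 * (μE * Q * (1 - r)))) := by
          -- Strictness of the sum needs at least one slot.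
          have : Nonempty (Fin s) := ⟨⟨0, hs⟩⟩
          refine Finset.sum_lt_sum_of_nonempty Finset.univ_nonempty fun k _ => ?_
          rw [← usedEnergy_eq hN td hK hx k (hpω k).1, (hpω k).2]
          have := hω k
          gcongr
      _ = _ := by
          rw [Finset.sum_const, Finset.card_univ, Fintype.card_fin, nsmul_eq_mul, hNs]
          field_simp
  calc 1 - fbt s b ϱ r ≤ 1 - PE.real (⋃ k, A k) :=
        sub_le_sub_left ((measureReal_iUnion_fintype_le _).trans htail) 1
    _ = PE.real (⋃ k, A k)ᶜ := (probReal_compl_eq_one_sub (MeasurableSet.iUnion hAm)).symm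
    -- The inclusion holds almost everywhere, and monotonicity asks for no measurability of the MMSE
    -- event.
    _ ≤ _ := ENNReal.toReal_mono (measure_ne_top _ _) (measure_mono_ae hgood)
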